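/- For a nonnegative integer $n$ let $M_n$ be the $n$-th Motzkin number, that is, the number of lattice paths from $(0,0)$ to $(n,0)$ which never dip below the line $y=0$ and are made up only of the steps $(1,0)$, $(1,1)$ and $(1,-1)$. (i) For every positive integer $n$, the number $$s(n) := \frac{2}{n}\sum_{k=1}^{n}(2k+1)M_k^2$$ is an integer. (ii) For every prime $p>3$, $$\sum_{k=0}^{p-1}(2k+1)M_k^2 \equiv 12p\left(\frac{p}{3}\right) \pmod{p^2},$$ where $\left(\frac{p}{3}\right)$ denotes the Legendre symbol. -/

import Mathlib

/-- The height (second coordinate) reached after the first `k` steps of the lattice path that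
starts at `(0, 0)` and whose `i`-th step is `(1, s i)`. -/
def pathHeight {n : ℕ} (s : Fin n → SignType) (k : ℕ) : ℤ :=
  ∑ i : Fin n with i.val < k, (s i : ℤ)

/-- The lattice paths from `(0, 0)` to `(n, 0)` with steps `(1, 0)`, `(1, 1)` and `(1, -1)` that
never dip below the line `y = 0`. Every step moves east by one, so such a path has exactly `n`
steps, and it is given by the vertical displacements `s i ∈ {0, 1, -1}` of its steps. -/
def motzkinPaths (n : ℕ) : Finset (Fin n → SignType) :=
  {s | (∀ k ≤ n, 0 ≤ pathHeight s k) ∧ pathHeight s n = 0}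

/-- The Motzkin number `M_n`. -/
def motzkin (n : ℕ) : ℕ := (motzkinPaths n).card

/-!
The sum `∑_{k<n} (2k+1) M_k²` telescopes. Let `T_n`, `U_n` and `V_n` be the coefficients of `x⁰`,
`x¹` and `x²` in `(x⁻¹ + 1 + x)ⁿ`. The reflection principle gives `M_n = T_n - V_n`
(`motzkin_eq`). Pascal's rule together with the identity obtained by differentiating the power
(`mul_trinom_succ`) gives `T_{n+1} = T_n + 2U_n`, `U_{n+1} = (n+1)M_n` and `2T_n + U_n = (n+2)M_n`,
and from these, by induction,
`∑_{k<n} (2k+1) M_k² = 1 - (T_n - U_n)(T_n - 7U_n + 4n(T_n - U_n))`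
(`sum_two_mul_add_one_mul_motzkin_sq`).

The integrality follows because `2(T_{n+1} - U_{n+1}) = n(3M_{n-1} - M_n)` (`two_mul_sum_Icc_eq`).

For the congruence take `n = p`, where `U_p = pM_{p-1}`. As `T_p ≡ 1 (mod p²)`
(`trinom_prime_modEq`), the sum is `4p(2M_{p-1} - 1)` modulo `p²`. Finally `T_{p-1} ≡ (p/3) (mod p)`
(`trinom_prime_sub_one_modEq`), and `2(p+1)M_{p-1} = T_p + 3T_{p-1}`, so that
`2M_{p-1} - 1 ≡ 3(p/3) (mod p)`.
-/

open Polynomial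

/-! ### Trinomial coefficients -/

/-- The trinomial coefficient `[x ^ h] (x⁻¹ + 1 + x) ^ n`, defined by its Pascal-type recursion. -/
def trinom : ℕ → ℤ → ℤ
  | 0, h => if h = 0 then 1 else 0
  | n + 1, h => trinom n (h - 1) + trinom n h + trinom n (h + 1)

theorem trinom_succ (n : ℕ) (h : ℤ) :
    trinom (n + 1) h = trinom n (h - 1) + trinom n h + trinom n (h + 1) := rfl

theorem trinom_neg (n : ℕ) (h : ℤ) : trinom n (-h) = trinom n h := by
  induction n generalizing h with
  | zero => simp [trinom]
  | succ n ih =>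
    rw [trinom_succ, trinom_succ, ← ih (h - 1), ← ih (h + 1), ih h,
      show -(h - 1) = -h + 1 by ring, show -(h + 1) = -h - 1 by ring]
    ring

/-- Comparison of coefficients in `x * d/dx (P ^ (n + 1)) = (n + 1) * (x - x⁻¹) * P ^ n` for
`P = x⁻¹ + 1 + x`. -/
theorem mul_trinom_succ (n : ℕ) (h : ℤ) :
    h * trinom (n + 1) h = (n + 1) * (trinom n (h - 1) - trinom n (h + 1)) := by
  induction n generalizing h with
  | zero =>
    simp only [trinom]
    split_ifs <;> omega
  | succ n ih =>
    have h₁ := ih (h - 1)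
    have h₂ := ih h
    have h₃ := ih (h + 1)
    simp only [sub_add_cancel, add_sub_cancel_right] at h₁ h₃
    rw [trinom_succ (n + 1)]
    have e₁ := trinom_succ n (h - 1)
    have e₃ := trinom_succ n (h + 1)
    simp only [sub_add_cancel, add_sub_cancel_right] at e₁ e₃
    push_cast
    linear_combination h₁ + h₂ + h₃ - (n + 1) * e₁ + (n + 1) * e₃

theorem trinom_eq_zero {n : ℕ} {h : ℤ} (hh : h < -n) : trinom n h = 0 := by
  induction n generalizing h with
  | zero =>
    have : h ≠ 0 := by simp at hh; omega
    simp [trinom, this]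
  | succ n ih =>
    push_cast at hh
    rw [trinom_succ, ih (by omega), ih (by omega), ih (by omega)]
    norm_num

theorem coeff_one_add_X_add_X_sq_pow (n k : ℕ) :
    ((1 + X + X ^ 2 : ℤ[X]) ^ n).coeff k = trinom n (k - n) := by
  induction n generalizing k with
  | zero => simp [trinom, coeff_one]
  | succ n ih =>
    rw [pow_succ, trinom_succ, mul_add, mul_add, mul_one, coeff_add, coeff_add, ih]
    rcases k with _ | _ | k
    · rw [trinom_eq_zero (n := n) (h := _ - _ - 1) (by push_cast; omega),
        trinom_eq_zero (n := n) (h := _ - ((n + 1 : ℕ) : ℤ)) (by push_cast; omega), coeff_mul_X_zero,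
        coeff_mul_X_pow']
      simp
    · rw [trinom_eq_zero (n := n) (h := _ - _ - 1) (by push_cast; omega), coeff_mul_X, ih,
        coeff_mul_X_pow']
      simp
      ring_nf
    · rw [coeff_mul_X, ih, coeff_mul_X_pow, ih]
      push_cast
      ring_nf

/-! ### Motzkin numbers as differences of trinomial coefficients -/

theorem pathHeight_snoc_of_le {n : ℕ} (s : Fin n → SignType) (σ : SignType) {k : ℕ} (hk : k ≤ n) :
    pathHeight (Fin.snoc s σ : Fin (n + 1) → SignType) k = pathHeight s k := by
  simp [pathHeight, Finset.sum_filter, Fin.sum_univ_castSucc, hk.not_gt]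

theorem pathHeight_snoc_last {n : ℕ} (s : Fin n → SignType) (σ : SignType) :
    pathHeight (Fin.snoc s σ : Fin (n + 1) → SignType) (n + 1) = pathHeight s n + σ := by
  simp [pathHeight, Finset.sum_filter, Fin.sum_univ_castSucc]

/-- The paths from `(0, 0)` to `(n, h)` with steps `(1, 0)`, `(1, 1)` and `(1, -1)` that never dip
below the line `y = 0`. -/
def nonnegPaths (n : ℕ) (h : ℤ) : Finset (Fin n → SignType) :=
  {s | (∀ k ≤ n, 0 ≤ pathHeight s k) ∧ pathHeight s n = h}

theorem nonnegPaths_eq_empty {n : ℕ} {h : ℤ} (hh : h < 0) : nonnegPaths n h = ∅ := by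
  ext s
  simp only [nonnegPaths, Finset.mem_filter, Finset.mem_univ, true_and, Finset.notMem_empty,
    iff_false, not_and]
  intro h₁ h₂
  have := h₁ n le_rfl
  omega

theorem snoc_mem_nonnegPaths {n : ℕ} {h : ℤ} (hh : 0 ≤ h) (s : Fin n → SignType) (σ : SignType) :
    (Fin.snoc s σ : Fin (n + 1) → SignType) ∈ nonnegPaths (n + 1) h ↔ s ∈ nonnegPaths n (h - σ) := by
  simp only [nonnegPaths, Finset.mem_filter, Finset.mem_univ, true_and, pathHeight_snoc_last,
    Nat.le_succ_iff, or_imp, forall_and, forall_eq, eq_sub_iff_add_eq]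
  constructor
  · rintro ⟨⟨h₁, -⟩, h₂⟩
    exact ⟨fun k hk => pathHeight_snoc_of_le s σ hk ▸ h₁ k hk, h₂⟩
  · rintro ⟨h₁, h₂⟩
    exact ⟨⟨fun k hk => (pathHeight_snoc_of_le s σ hk).symm ▸ h₁ k hk, h₂ ▸ hh⟩, h₂⟩

/-- Removing the last step. -/
theorem card_nonnegPaths_succ {n : ℕ} {h : ℤ} (hh : 0 ≤ h) :
    (nonnegPaths (n + 1) h).card = (nonnegPaths n (h - 1)).card + (nonnegPaths n h).card
      + (nonnegPaths n (h + 1)).card := by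
  have key : (nonnegPaths (n + 1) h).card = ∑ σ : SignType, (nonnegPaths n (h - σ)).card := by
    rw [← Finset.card_sigma]
    refine Finset.card_bij' (fun s _ => ⟨s (Fin.last n), Fin.init s⟩)
      (fun x _ => (Fin.snoc x.2 x.1 : Fin (n + 1) → SignType)) ?_ ?_ ?_ ?_
    · intro s hs
      simpa [← snoc_mem_nonnegPaths hh] using hs
    · intro x hx
      simpa [snoc_mem_nonnegPaths hh] using hx
    · intro s _
      simp
    · intro x _
      simp
  have hu : (Finset.univ : Finset SignType) = {1, 0, -1} := by decide
  rw [key, hu, Finset.sum_insert (by decide), Finset.sum_insert (by decide), Finset.sum_singleton]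
  simp [add_assoc]

/-- The reflection principle: both sides obey the same recursion for `h ≥ 0`, and both vanish at
`h = -1`. -/
theorem card_nonnegPaths (n : ℕ) {h : ℤ} (hh : -1 ≤ h) :
    ((nonnegPaths n h).card : ℤ) = trinom n h - trinom n (h + 2) := by
  induction n generalizing h with
  | zero =>
    have : nonnegPaths 0 h = if h = 0 then Finset.univ else ∅ := by
      ext s
      split_ifs with h0 <;> simp [nonnegPaths, pathHeight, h0, eq_comm]
    have h2 : h + 2 ≠ 0 := by omega
    rw [this]
    split_ifs with h0 <;> simp [trinom, h0, h2]
  | succ n ih =>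
    rcases hh.eq_or_lt with rfl | hh
    · rw [nonnegPaths_eq_empty (by norm_num), trinom_neg (n + 1) 1]
      norm_num
    · rw [card_nonnegPaths_succ (by omega)]
      push_cast
      rw [ih (by omega), ih (by omega), ih (by omega), trinom_succ n h, trinom_succ n (h + 2),
        show h - 1 + 2 = h + 2 - 1 by ring, show h + 1 + 2 = h + 2 + 1 by ring]
      ring

theorem motzkin_eq (n : ℕ) : (motzkin n : ℤ) = trinom n 0 - trinom n 2 :=
  card_nonnegPaths n (h := 0) (by norm_num)

theorem trinom_succ_zero (n : ℕ) :
    trinom (n + 1) 0 = trinom n 0 + 2 * trinom n 1 := by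
  rw [trinom_succ, show (0 : ℤ) - 1 = -1 by norm_num, trinom_neg, zero_add]
  ring

theorem trinom_succ_one (n : ℕ) : trinom (n + 1) 1 = (n + 1) * motzkin n := by
  have := mul_trinom_succ n 1
  norm_num at this
  rw [this, motzkin_eq]

/-- Two evaluations of `trinom (n + 1) 1`, by the recursion and by `trinom_succ_one`. -/
theorem two_mul_trinom_zero_add (n : ℕ) :
    2 * trinom n 0 + trinom n 1 = (n + 2) * motzkin n := by
  have h₁ := trinom_succ n 1
  norm_num at h₁
  linear_combination trinom_succ_one n - h₁ - motzkin_eq n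

/-! ### The closed form of the sum -/

/-- The sum telescopes: it is a quadratic form in two trinomial coefficients. -/
theorem sum_two_mul_add_one_mul_motzkin_sq (n : ℕ) :
    ∑ k ∈ Finset.range n, (2 * (k : ℤ) + 1) * (motzkin k : ℤ) ^ 2 =
      1 - (trinom n 0 - trinom n 1) *
        (trinom n 0 - 7 * trinom n 1 + 4 * n * (trinom n 0 - trinom n 1)) := by
  induction n with
  | zero => simp [trinom]
  | succ n ih =>
    rw [Finset.sum_range_succ, ih, trinom_succ_zero, trinom_succ_one]
    have h := two_mul_trinom_zero_add n
    have hU : trinom n 1 = (n + 2) * motzkin n - 2 * trinom n 0 := by linarith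
    rw [hU]
    push_cast
    ring

/-- The factor `n` comes from `2 * (T (n + 1) - U (n + 1)) = n * (3 * M (n - 1) - M n)`, where
`T = trinom · 0`, `U = trinom · 1` and `M = motzkin`. -/
theorem two_mul_sum_Icc_eq {n : ℕ} (hn : 0 < n) :
    2 * ∑ k ∈ Finset.Icc 1 n, (2 * (k : ℤ) + 1) * (motzkin k : ℤ) ^ 2 =
      n * ((motzkin n - 3 * motzkin (n - 1)) *
        (trinom (n + 1) 0 - 7 * trinom (n + 1) 1 +
          4 * (n + 1) * (trinom (n + 1) 0 - trinom (n + 1) 1))) := by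
  obtain ⟨m, rfl⟩ : ∃ m, n = m + 1 := ⟨n - 1, by omega⟩
  have hS := sum_two_mul_add_one_mul_motzkin_sq (m + 1 + 1)
  rw [Finset.range_eq_Ico, Finset.sum_eq_sum_Ico_succ_bot (by omega)] at hS
  have h0 : motzkin 0 = 1 := by
    have := motzkin_eq 0
    norm_num [trinom] at this
    exact this
  have hD : 2 * (trinom (m + 1 + 1) 0 - trinom (m + 1 + 1) 1) =
      (m + 1) * (3 * motzkin m - motzkin (m + 1)) := by
    have h := two_mul_trinom_zero_add (m + 1)
    rw [trinom_succ_zero (m + 1), trinom_succ_one (m + 1)]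
    rw [trinom_succ_one m] at h ⊢
    push_cast at h ⊢
    linear_combination h
  rw [show Finset.Icc 1 (m + 1) = Finset.Ico (0 + 1) (m + 1 + 1) from rfl, add_tsub_cancel_right]
  rw [h0] at hS
  push_cast at hS ⊢
  linear_combination 2 * hS - hD * (trinom (m + 1 + 1) 0 - 7 * trinom (m + 1 + 1) 1 +
    4 * (m + 1 + 1) * (trinom (m + 1 + 1) 0 - trinom (m + 1 + 1) 1))

/-! ### Central trinomial coefficients at primes -/

/-- In characteristic `p`, `(1 + X + X ^ 2) ^ p = 1 + X ^ p + X ^ (2 * p)`. -/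
theorem prime_dvd_coeff_one_add_X_add_X_sq_pow {p : ℕ} (hp : p.Prime) {k : ℕ} (h0 : 0 < k)
    (hk : k < p) : (p : ℤ) ∣ ((1 + X + X ^ 2 : ℤ[X]) ^ p).coeff k := by
  have := Fact.mk hp
  have h : (1 + X + X ^ 2 : (ZMod p)[X]) ^ p = 1 + X ^ p + X ^ (2 * p) := by
    rw [add_pow_char, add_pow_char, one_pow, ← pow_mul]
  have hmap : ((1 + X + X ^ 2 : ℤ[X]) ^ p).map (Int.castRingHom (ZMod p)) =
      (1 + X + X ^ 2 : (ZMod p)[X]) ^ p := by simp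
  rw [← ZMod.intCast_zmod_eq_zero_iff_dvd, ← eq_intCast (Int.castRingHom (ZMod p)), ← coeff_map, hmap, h]
  simp [coeff_one, coeff_X_pow, h0.ne', hk.ne]
  omega

/-- Compare coefficients of `X ^ p` in `(1 + X + X ^ 2) ^ p * (X - 1) ^ p = (X ^ 3 - 1) ^ p`: the
right-hand side has none as `p ≠ 3`, and in each middle term of the convolution both factors are
divisible by `p`. -/
theorem trinom_prime_modEq {p : ℕ} (hp : p.Prime) (h3 : 3 < p) :
    trinom p 0 ≡ 1 [ZMOD (p : ℤ) ^ 2] := by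
  have hprod : (1 + X + X ^ 2 : ℤ[X]) ^ p * (X + C (-1)) ^ p = expand ℤ 3 ((X + C (-1)) ^ p) := by
    rw [← mul_pow, map_pow, map_add, expand_X, expand_C, C_neg, C_1]
    ring
  have h := congrArg (fun f => coeff f p) hprod
  have hndvd : ¬ 3 ∣ p := fun hd => by
    have := (Nat.prime_dvd_prime_iff_eq Nat.prime_three hp).1 hd
    omega
  simp only [coeff_mul, coeff_expand (by norm_num : 0 < 3), if_neg hndvd] at h
  rw [Finset.Nat.sum_antidiagonal_eq_sum_range_succ
    (fun i j => ((1 + X + X ^ 2 : ℤ[X]) ^ p).coeff i * ((X + C (-1) : ℤ[X]) ^ p).coeff j),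
    Finset.sum_range_succ, Finset.range_eq_Ico, Finset.sum_eq_sum_Ico_succ_bot hp.pos] at h
  have hmid : (p : ℤ) ^ 2 ∣ ∑ k ∈ Finset.Ico (0 + 1) p,
      ((1 + X + X ^ 2 : ℤ[X]) ^ p).coeff k * ((X + C (-1) : ℤ[X]) ^ p).coeff (p - k) := by
    refine Finset.dvd_sum fun k hk => ?_
    rw [Finset.mem_Ico] at hk
    rw [sq]
    refine mul_dvd_mul (prime_dvd_coeff_one_add_X_add_X_sq_pow hp (by omega) hk.2) ?_
    rw [coeff_X_add_C_pow]
    exact (Int.natCast_dvd_natCast.2 (hp.dvd_choose_self (by omega) (by omega))).mul_left _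
  have hA0 : ((1 + X + X ^ 2 : ℤ[X]) ^ p).coeff 0 = 1 := by
    simp [coeff_zero_eq_eval_zero]
  rw [hA0, coeff_one_add_X_add_X_sq_pow, coeff_X_add_C_pow, coeff_X_add_C_pow] at h
  simp only [tsub_zero, tsub_self, sub_self, pow_zero, Nat.choose_self, Nat.choose_zero_right,
    Nat.cast_one, mul_one, (hp.odd_of_ne_two (by omega)).neg_one_pow] at h
  obtain ⟨c, hc⟩ := hmid
  rw [hc] at h
  exact (Int.modEq_iff_dvd.2 ⟨-c, by linear_combination h⟩)

/-- Modulo `p`, the identity `(1 + X + X ^ 2) ^ (p - 1) * (1 + X + X ^ 2) = 1 + X ^ p + X ^ (2 * p)`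
makes the coefficients of the first factor below `X ^ p` repeat the pattern `1, -1, 0`. -/
theorem trinom_prime_sub_one_modEq {p : ℕ} (hp : p.Prime) (h3 : 3 < p) :
    trinom (p - 1) 0 ≡ legendreSym 3 p [ZMOD p] := by
  have := Fact.mk hp
  set b : ℕ → ZMod p := fun k => ((1 + X + X ^ 2 : (ZMod p)[X]) ^ (p - 1)).coeff k with hb
  have h : (1 + X + X ^ 2 : (ZMod p)[X]) ^ (p - 1) * (1 + X + X ^ 2) = 1 + X ^ p + X ^ (2 * p) := by
    rw [pow_sub_one_mul hp.ne_zero, add_pow_char, add_pow_char, one_pow, ← pow_mul]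
  have hb0 : b 0 = 1 := by simp [hb, coeff_zero_eq_eval_zero]
  have hb1 : b 1 = -1 := by
    have := congrArg (fun f => coeff f 1) h
    simp [mul_add, coeff_mul_X_pow', coeff_one, coeff_X_pow, hp.one_lt.ne,
      coeff_mul_X] at this
    rw [if_neg (by omega)] at this
    simp only [hb] at hb0 ⊢
    rw [hb0] at this
    linear_combination this
  have hrec : ∀ k, k + 2 < p → b (k + 2) = -b (k + 1) - b k := by
    intro k hk
    have := congrArg (fun f => coeff f (k + 2)) h
    simp only [mul_add, mul_one, coeff_add, coeff_mul_X_pow, coeff_mul_X, coeff_one, coeff_X_pow,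
      if_neg hk.ne] at this
    rw [if_neg (by omega), if_neg (by omega)] at this
    simp only [hb]
    linear_combination this
  have hper : ∀ j, (3 * j < p → b (3 * j) = 1) ∧ (3 * j + 1 < p → b (3 * j + 1) = -1) := by
    intro j
    induction j with
    | zero => exact ⟨fun _ => hb0, fun _ => hb1⟩
    | succ j ih =>
      have h₂ : 3 * j + 2 < p → b (3 * j + 2) = 0 := fun hj => by
        rw [hrec _ hj, ih.1 (by omega), ih.2 (by omega)]; ring
      have h₃ : 3 * j + 3 < p → b (3 * j + 3) = 1 := fun hj => by
        rw [hrec _ hj, h₂ (by omega), ih.2 (by omega)]; ring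
      refine ⟨h₃, fun hj => ?_⟩
      rw [show 3 * (j + 1) + 1 = 3 * j + 2 + 2 by ring, hrec _ (by omega), h₂ (by omega),
        h₃ (by omega)]
      ring
  have hT : ((trinom (p - 1) 0 : ℤ) : ZMod p) = b (p - 1) := by
    have hmap : ((1 + X + X ^ 2 : ℤ[X]) ^ (p - 1)).map (Int.castRingHom (ZMod p)) =
        (1 + X + X ^ 2 : (ZMod p)[X]) ^ (p - 1) := by simp
    have := coeff_one_add_X_add_X_sq_pow (p - 1) (p - 1)
    rw [sub_self] at this
    simp only [hb]
    rw [← this, ← hmap, coeff_map, eq_intCast]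
  rw [← ZMod.intCast_eq_intCast_iff, hT, legendreSym.mod]
  have hndvd : ¬ 3 ∣ p := fun hd => by
    have := (Nat.prime_dvd_prime_iff_eq Nat.prime_three hp).1 hd
    omega
  obtain hr | hr : p % 3 = 1 ∨ p % 3 = 2 := by omega
  · rw [show ((p : ℤ) % (3 : ℕ)) = 1 by omega, legendreSym.at_one,
      show p - 1 = 3 * (p / 3) by omega, (hper _).1 (by omega)]
    simp
  · rw [show ((p : ℤ) % (3 : ℕ)) = 2 by omega, show legendreSym 3 2 = -1 by decide,
      show p - 1 = 3 * (p / 3) + 1 by omega, (hper _).2 (by omega)]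
    simp

/-- Since `2 * (p + 1) * motzkin (p - 1) = trinom p 0 + 3 * trinom (p - 1) 0`. -/
theorem two_mul_motzkin_prime_sub_one_modEq {p : ℕ} (hp : p.Prime) (h3 : 3 < p) :
    2 * (motzkin (p - 1) : ℤ) ≡ 1 + 3 * legendreSym 3 p [ZMOD p] := by
  obtain ⟨a, ha⟩ := (trinom_prime_modEq hp h3).dvd
  obtain ⟨b, hb⟩ := (trinom_prime_sub_one_modEq hp h3).dvd
  have h₁ := two_mul_trinom_zero_add (p - 1)
  have h₂ := trinom_succ_zero (p - 1)
  rw [Nat.sub_add_cancel hp.one_le] at h₂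
  push_cast [hp.one_le] at h₁
  refine Int.modEq_iff_dvd.2 ⟨2 * motzkin (p - 1) + p * a + 3 * b, ?_⟩
  linear_combination ha + 3 * hb + 2 * h₁ + h₂

theorem theorem1p1 :
    (∀ n : ℕ, 0 < n →
      ∃ m : ℤ, (2 / (n : ℚ)) * ∑ k ∈ Finset.Icc 1 n, (2 * (k : ℚ) + 1) * (motzkin k : ℚ) ^ 2
        = (m : ℚ)) ∧
    (∀ p : ℕ, p.Prime → 3 < p →
      (∑ k ∈ Finset.range p, (2 * (k : ℤ) + 1) * (motzkin k : ℤ) ^ 2)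
        ≡ 12 * (p : ℤ) * legendreSym 3 (p : ℤ) [ZMOD (p : ℤ) ^ 2]) := by
  constructor
  · intro n hn
    have hq := congrArg (Int.cast : ℤ → ℚ) (two_mul_sum_Icc_eq hn)
    refine ⟨_, (?_ : _ = (Int.cast ((motzkin n - 3 * motzkin (n - 1)) *
        (trinom (n + 1) 0 - 7 * trinom (n + 1) 1 +
          4 * (n + 1) * (trinom (n + 1) 0 - trinom (n + 1) 1)) : ℤ) : ℚ))⟩
    rw [div_mul_eq_mul_div, div_eq_iff (by positivity), mul_comm (Int.cast _)]
    exact_mod_cast hq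
  · intro p hp h3
    have hU := trinom_succ_one (p - 1)
    rw [Nat.sub_add_cancel hp.one_le] at hU
    push_cast [hp.one_le] at hU
    obtain ⟨a, ha⟩ := (trinom_prime_modEq hp h3).dvd
    obtain ⟨b, hb⟩ := (two_mul_motzkin_prime_sub_one_modEq hp h3).dvd
    rw [sum_two_mul_add_one_mul_motzkin_sq, hU, show trinom p 0 = 1 - p ^ 2 * a by linarith]
    -- modulo `p ^ 2` the sum is `1 - (1 - p * M) * (1 - 7 * p * M + 4 * p) = 4 * p * (2 * M - 1)`
    set M : ℤ := (motzkin (p - 1) : ℤ)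
    set L : ℤ := legendreSym 3 p
    clear_value M L
    refine Int.modEq_iff_dvd.2 ⟨4 * b - 2 * a - 8 * M + 7 * M ^ 2 - 8 * p * a + 8 * p * a * M
      + 4 * p * M ^ 2 + 8 * p ^ 2 * a * M + p ^ 2 * a ^ 2 + 4 * p ^ 3 * a ^ 2, ?_⟩
    linear_combination 4 * p * hb
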